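/- Let $n\ge 1$ be an integer and let $\mathcal H^{s}$ denote the $s$-dimensional Hausdorff measure on $\mathbb R^n$ with the Euclidean metric, normalized by $\mathcal H^{s}(A)=\lim_{\delta\to0}\inf\{\sum_i \operatorname{diam}(U_i)^s : A\subseteq\bigcup_i U_i,\ \operatorname{diam}(U_i)\le\delta\}$ over countable covers (for $s=0$, counting measure). An $n$-cube antichain is a set $S\subseteq[0,1]^n$ that contains no two distinct points $x,y$ with $x_i\le y_i$ for all $i$. Call $S$ smooth if it is $\mathcal H^{n-1}$-measurable and each $x\in S$ has an open neighbourhood $U$ and a $C^1$ function $g:U\to\mathbb R$ with $\nabla g(x)\ne0$ and $g=0$ on $S\cap U$. (This includes all embedded $C^1$, in particular $C^\infty$, hypersurfaces with or without boundary and corners, and the graph $x_n=f(x_1,\dots,x_{n-1})$ of any function $f$ on a measurable set that extends locally to a $C^1$ function.) For $1\le j\le n$ let $\pi_j(x_1,\dots,x_n)=(x_1,\dots,x_{j-1},0,x_{j+1},\dots,x_n)$, and let $\sigma_m=\dfrac{2^m\,\Gamma(m/2+1)}{\pi^{m/2}}$. If $S$ is a smooth $n$-cube antichain, then \[\mathcal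 H^{n-1}(S)\le\sum_{j=1}^n\mathcal H^{n-1}(\pi_j(S)),\] and moreover $\mathcal H^{n-1}(S)\le n\,\sigma_{n-1}$. -/

import Mathlib

open MeasureTheory Topology

/-- An `n`-cube antichain: a subset of `[0,1]^n` that does not contain two (distinct) points
`x`, `y` with `x i ≤ y i` for all `i`. -/
def IsCubeAntichain {n : ℕ} (S : Set (EuclideanSpace ℝ (Fin n))) : Prop :=
  (∀ x ∈ S, ∀ i, x i ∈ Set.Icc (0 : ℝ) 1) ∧
    IsAntichain (fun x y : EuclideanSpace ℝ (Fin n) => ∀ i, x i ≤ y i) S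

/-- `S` is a smooth hypersurface piece in `ℝ^n`: it is `H^{n-1}`-measurable, and near each of its
points it lies in a regular level set `{g = 0}` of a `C¹` function `g`.

This covers embedded hypersurfaces of class `C¹` (in particular `C^∞`), without boundary or with
boundary and corners, as well as graphs `x_n = f (x_1, …, x_{n-1})` of `C¹` functions over an
arbitrary measurable domain (take `g = x_n - f`). Measurability is automatic for an embedded
hypersurface; it has to be mentioned only because no shape of the domain is prescribed. -/
structure IsSmoothHypersurface {n : ℕ} (S : Set (EuclideanSpace ℝ (Fin n))) : Prop where
  measurable : NullMeasurableSet S (μH[((n - 1 : ℕ) : ℝ)])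
  exists_defining : ∀ x ∈ S, ∃ g : EuclideanSpace ℝ (Fin n) → ℝ,
    ContDiffAt ℝ 1 g x ∧ fderiv ℝ g x ≠ 0 ∧ ∀ᶠ y in 𝓝[S] x, g y = 0

/-- The projection `π_j`, which sets the `j`-th coordinate to zero. -/
def coordProj {n : ℕ} (j : Fin n) (x : EuclideanSpace ℝ (Fin n)) : EuclideanSpace ℝ (Fin n) :=
  WithLp.toLp 2 (Function.update x.ofLp j 0)

/-- `σ_m = 2^m Γ(m/2 + 1) / π^{m/2}`. -/
noncomputable def sigmaConst (m : ℕ) : ℝ :=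
  2 ^ m * Real.Gamma ((m : ℝ) / 2 + 1) / Real.pi ^ ((m : ℝ) / 2)

open Filter Metric Set
open scoped NNReal ENNReal

/-! Write `m = n - 1`. On a hyperplane with unit normal `ν`, `π_j` scales `m`-dimensional measure by
`|ν_j|`, and `∑ |ν_j| ≥ ∑ ν_j² = 1`, so a flat piece measures at most the sum of its projections.
Near each point a smooth `S` is flat up to a factor close to `1` (`exists_orthonormalBasis_flat`,
`exists_hausdorffMeasure_le_of_flat`). An antichain projects injectively, so disjoint pieces have
disjoint projections and the local bounds add up (`hausdorffMeasure_le_sum_of_locally`). Each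
projection lies in a unit `m`-cube, of `μH[m]`-measure at most `σ_m`. -/

/-! ### Hausdorff measure: comparison of images, and comparison with Lebesgue measure -/

/-- If distances between the values of `f` are at most `K` times those between the values of `g`,
then `f '' A` has at most `K ^ d` times the Hausdorff measure of `g '' A`. -/
theorem hausdorffMeasure_image_le_of_dist_le {α X Y : Type*} [MetricSpace X] [MeasurableSpace X]
    [BorelSpace X] [MetricSpace Y] [MeasurableSpace Y] [BorelSpace Y] {f : α → X} {g : α → Y}
    {A : Set α} {K : ℝ≥0} (h : ∀ y ∈ A, ∀ z ∈ A, dist (f y) (f z) ≤ K * dist (g y) (g z))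
    {d : ℝ} (hd : 0 ≤ d) : μH[d] (f '' A) ≤ (K : ℝ≥0∞) ^ d * μH[d] (g '' A) := by
  rcases A.eq_empty_or_nonempty with rfl | ⟨a, ha⟩
  · simp
  have : Nonempty α := ⟨a⟩
  have hinv : ∀ p ∈ g '' A, Function.invFunOn g A p ∈ A ∧ g (Function.invFunOn g A p) = p :=
    fun p hp => Function.invFunOn_pos hp
  have hL : LipschitzOnWith K (f ∘ Function.invFunOn g A) (g '' A) := by
    refine LipschitzOnWith.of_dist_le_mul fun p hp q hq => ?_
    have := h _ (hinv p hp).1 _ (hinv q hq).1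
    rwa [(hinv p hp).2, (hinv q hq).2] at this
  -- By `h`, points of `A` with equal `g`-values have equal `f`-values, so the choice of preimage is
  -- harmless.
  have hf : f '' A = (f ∘ Function.invFunOn g A) '' (g '' A) := by
    rw [image_image]
    refine image_congr fun x hx => ?_
    have hx' := hinv (g x) (mem_image_of_mem g hx)
    have := h x hx _ hx'.1
    rw [hx'.2, dist_self, mul_zero] at this
    exact dist_le_zero.1 this
  rw [hf]
  exact hL.hausdorffMeasure_image_le hd

/-- The volume of the unit cube of `ℝ^m` is `1`. -/
theorem volume_euclideanSpace_unitCube (m : ℕ) :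
    volume {x : EuclideanSpace ℝ (Fin m) | ∀ i, x i ∈ Icc (0 : ℝ) 1} = 1 := by
  have h := (EuclideanSpace.volume_preserving_symm_measurableEquiv_toLp (Fin m)).measure_preimage
    (s := Icc 0 1) measurableSet_Icc.nullMeasurableSet
  have hs : {x : EuclideanSpace ℝ (Fin m) | ∀ i, x i ∈ Icc (0 : ℝ) 1} =
      (MeasurableEquiv.toLp 2 (Fin m → ℝ)).symm ⁻¹' Icc 0 1 := by
    ext x
    simp [Pi.le_def, forall_and]
  rw [hs, h, Real.volume_Icc_pi]
  simp

/-- The volume of a Euclidean ball, in terms of its diameter. -/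
theorem ofReal_two_mul_pow_eq_sigmaConst_mul_volume {m : ℕ} (x : EuclideanSpace ℝ (Fin m)) {r : ℝ}
    (hr : 0 ≤ r) :
    ENNReal.ofReal (2 * r) ^ m = ENNReal.ofReal (sigmaConst m) * volume (closedBall x r) := by
  rcases Nat.eq_zero_or_pos m with rfl | hm
  · have hb : closedBall x r = {x : EuclideanSpace ℝ (Fin 0) | ∀ i, x i ∈ Icc (0 : ℝ) 1} := by
      ext y
      simpa [Subsingleton.elim y x] using hr
    rw [hb, volume_euclideanSpace_unitCube]
    simp [sigmaConst]
  · have : Nonempty (Fin m) := ⟨⟨0, hm⟩⟩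
    have hG : 0 < Real.Gamma ((m : ℝ) / 2 + 1) := Real.Gamma_pos_of_pos (by positivity)
    have hpi : √Real.pi ^ m = Real.pi ^ ((m : ℝ) / 2) := by
      rw [Real.sqrt_eq_rpow, ← Real.rpow_mul_natCast Real.pi_pos.le]
      ring_nf
    rw [EuclideanSpace.volume_closedBall, Fintype.card_fin, hpi, ← ENNReal.ofReal_pow hr,
      ← ENNReal.ofReal_pow (by positivity), ← ENNReal.ofReal_mul (by positivity),
      ← ENNReal.ofReal_mul (by unfold sigmaConst; positivity)]
    congr 1
    have : 0 < Real.pi ^ ((m : ℝ) / 2) := by positivity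
    rw [sigmaConst, mul_pow]
    field_simp

/-- The Hausdorff measure on `ℝ^m` is at most `σ_m` times Lebesgue measure. -/
theorem hausdorffMeasure_le_sigmaConst_mul_volume {m : ℕ} (s : Set (EuclideanSpace ℝ (Fin m))) :
    μH[(m : ℝ)] s ≤ ENNReal.ofReal (sigmaConst m) * volume s := by
  -- Besicovitch: small balls cover `s` with almost no excess volume. For balls, `diam ^ m` is at
  -- most `σ_m` times volume, so no isodiametric inequality is needed.
  have hcov : ∀ k : ℕ, ∃ (t : Set (EuclideanSpace ℝ (Fin m))) (r : EuclideanSpace ℝ (Fin m) → ℝ),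
      t.Countable ∧ t ⊆ s ∧ (∀ x ∈ t, r x ∈ Ioo (0 : ℝ) (1 / ((k : ℝ) + 1))) ∧
      (s ⊆ ⋃ x ∈ t, closedBall x (r x)) ∧
      (∑' x : t, volume (closedBall (x : EuclideanSpace ℝ (Fin m)) (r x))) ≤
        volume s + ((k : ℝ≥0∞) + 1)⁻¹ := by
    intro k
    refine Besicovitch.exists_closedBall_covering_tsum_measure_le volume
      (ENNReal.inv_ne_zero.2 (by finiteness)) (fun _ => Ioo (0 : ℝ) (1 / ((k : ℝ) + 1))) s ?_
    intro x _ δ hδ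
    rw [Ioo_inter_Ioo, nonempty_Ioo]
    simp only [max_self, lt_inf_iff]
    exact ⟨by positivity, hδ⟩
  choose t r htc _ hr hst hvol using hcov
  have : ∀ k, Countable (t k) := fun k => (htc k).to_subtype
  have hlim : Tendsto (fun k : ℕ => ENNReal.ofReal (2 * (1 / ((k : ℝ) + 1)))) atTop (𝓝 0) := by
    rw [← ENNReal.ofReal_zero]
    refine ENNReal.tendsto_ofReal ?_
    simpa using (tendsto_one_div_add_atTop_nhds_zero_nat (𝕜 := ℝ)).const_mul 2
  have hdiam : ∀ k, ∀ x : t k, ediam (closedBall (x : EuclideanSpace ℝ (Fin m)) (r k x)) ≤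
      ENNReal.ofReal (2 * r k x) := fun k x => by
    rw [← Metric.closedEBall_ofReal (hr k x x.2).1.le]
    refine Metric.ediam_closedEBall_le.trans ?_
    rw [ENNReal.ofReal_mul (by norm_num)]; simp
  refine (Measure.hausdorffMeasure_le_liminf_tsum (m : ℝ) s _ hlim
    (fun k (x : t k) => closedBall (x : EuclideanSpace ℝ (Fin m)) (r k x))
    (Eventually.of_forall fun k x => (hdiam k x).trans
      (ENNReal.ofReal_le_ofReal (by linarith [(hr k x x.2).2])))
    (Eventually.of_forall fun k => by simpa only [iUnion_subtype] using hst k)).trans ?_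
  have hsum : ∀ k, ∑' x : t k, ediam (closedBall (x : EuclideanSpace ℝ (Fin m)) (r k x)) ^ (m : ℝ) ≤
      ENNReal.ofReal (sigmaConst m) * (volume s + ((k : ℝ≥0∞) + 1)⁻¹) := fun k => by
    refine le_trans ?_ (mul_le_mul_right (hvol k) _)
    rw [← ENNReal.tsum_mul_left]
    refine ENNReal.tsum_le_tsum fun x => ?_
    rw [← ofReal_two_mul_pow_eq_sigmaConst_mul_volume _ (hr k x x.2).1.le, ENNReal.rpow_natCast]
    gcongr
    exact hdiam k x
  have hlim' : Tendsto (fun k : ℕ => ENNReal.ofReal (sigmaConst m) *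
      (volume s + ((k : ℝ≥0∞) + 1)⁻¹)) atTop (𝓝 (ENNReal.ofReal (sigmaConst m) * volume s)) := by
    refine ENNReal.Tendsto.const_mul ?_ (Or.inr ENNReal.ofReal_ne_top)
    have h0 : Tendsto (fun k : ℕ => ((k : ℝ≥0∞) + 1)⁻¹) atTop (𝓝 0) := by
      have := (tendsto_add_atTop_iff_nat 1).2 ENNReal.tendsto_inv_nat_nhds_zero
      simpa using this
    simpa using h0.const_add (volume s)
  rw [← hlim'.liminf_eq]
  exact liminf_le_liminf (Eventually.of_forall hsum)

/-! ### Coordinate projections -/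

/-- The linear map `ℝ^(m+1) → ℝ^m` that forgets the `j`-th coordinate. -/
noncomputable def dropCoord {m : ℕ} (j : Fin (m + 1)) :
    EuclideanSpace ℝ (Fin (m + 1)) →ₗ[ℝ] EuclideanSpace ℝ (Fin m) where
  toFun x := WithLp.toLp 2 fun i => x (j.succAbove i)
  map_add' _ _ := rfl
  map_smul' _ _ := rfl

@[simp]
theorem dropCoord_apply {m : ℕ} (j : Fin (m + 1)) (x : EuclideanSpace ℝ (Fin (m + 1)))
    (i : Fin m) : dropCoord j x i = x (j.succAbove i) := rfl

theorem norm_sq_eq_sq_add_norm_dropCoord_sq {m : ℕ} (j : Fin (m + 1))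
    (x : EuclideanSpace ℝ (Fin (m + 1))) : ‖x‖ ^ 2 = x j ^ 2 + ‖dropCoord j x‖ ^ 2 := by
  simp [EuclideanSpace.real_norm_sq_eq, Fin.sum_univ_succAbove _ j]

theorem norm_dropCoord_le {m : ℕ} (j : Fin (m + 1)) (x : EuclideanSpace ℝ (Fin (m + 1))) :
    ‖dropCoord j x‖ ≤ ‖x‖ := by
  refine le_of_sq_le_sq ?_ (norm_nonneg _)
  rw [norm_sq_eq_sq_add_norm_dropCoord_sq j x]
  nlinarith [sq_nonneg (x j)]

theorem norm_le_abs_add_norm_dropCoord {m : ℕ} (j : Fin (m + 1))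
    (x : EuclideanSpace ℝ (Fin (m + 1))) : ‖x‖ ≤ |x j| + ‖dropCoord j x‖ := by
  refine le_of_sq_le_sq ?_ (by positivity)
  rw [norm_sq_eq_sq_add_norm_dropCoord_sq j x, add_sq, sq_abs]
  have := mul_nonneg (abs_nonneg (x j)) (norm_nonneg (dropCoord j x))
  linarith

theorem dist_coordProj {m : ℕ} (j : Fin (m + 1)) (x y : EuclideanSpace ℝ (Fin (m + 1))) :
    dist (coordProj j x) (coordProj j y) = dist (dropCoord j x) (dropCoord j y) := by
  simp [EuclideanSpace.dist_eq, Fin.sum_univ_succAbove _ j, coordProj]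

theorem hausdorffMeasure_coordProj_image {m : ℕ} (j : Fin (m + 1))
    (A : Set (EuclideanSpace ℝ (Fin (m + 1)))) {d : ℝ} (hd : 0 ≤ d) :
    μH[d] (coordProj j '' A) = μH[d] (dropCoord j '' A) := by
  refine le_antisymm ?_ ?_
  · simpa using hausdorffMeasure_image_le_of_dist_le (K := 1) (f := coordProj j)
      (g := dropCoord j) (A := A) (fun y _ z _ => by simp [dist_coordProj]) hd
  · simpa using hausdorffMeasure_image_le_of_dist_le (K := 1) (f := dropCoord j)
      (g := coordProj j) (A := A) (fun y _ z _ => by simp [dist_coordProj]) hd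

theorem continuous_coordProj {n : ℕ} (j : Fin n) : Continuous (coordProj j) := by
  unfold coordProj
  fun_prop

/-- Points differing only in coordinate `j` are comparable. The antichain condition is used only
here. -/
theorem IsCubeAntichain.injOn_coordProj {n : ℕ} {S : Set (EuclideanSpace ℝ (Fin n))}
    (hS : IsCubeAntichain S) (j : Fin n) : InjOn (coordProj j) S := by
  intro x hx y hy hxy
  have hne : ∀ i, i ≠ j → x i = y i := fun i hi => by
    have := congrArg (fun z : EuclideanSpace ℝ (Fin n) => z i) hxy
    simpa [coordProj, hi] using this
  by_contra hxy'
  rcases le_total (x j) (y j) with h | h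
  · refine hS.2 hx hy hxy' fun i => ?_
    by_cases hi : i = j
    · exact hi ▸ h
    · exact (hne i hi).le
  · refine hS.2 hy hx (Ne.symm hxy') fun i => ?_
    by_cases hi : i = j
    · exact hi ▸ h
    · exact (hne i hi).ge

theorem IsCubeAntichain.hausdorffMeasure_coordProj_image_le {m : ℕ}
    {S : Set (EuclideanSpace ℝ (Fin (m + 1)))} (hS : IsCubeAntichain S) (j : Fin (m + 1)) :
    μH[(m : ℝ)] (coordProj j '' S) ≤ ENNReal.ofReal (sigmaConst m) := by
  rw [hausdorffMeasure_coordProj_image j S (Nat.cast_nonneg m)]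
  refine (measure_mono (?_ : _ ⊆ {x | ∀ i, x i ∈ Icc (0 : ℝ) 1})).trans
    ((hausdorffMeasure_le_sigmaConst_mul_volume _).trans_eq ?_)
  · rintro _ ⟨x, hx, rfl⟩ i
    exact hS.1 x hx _
  · rw [volume_euclideanSpace_unitCube, mul_one]

/-! ### Nearly flat sets -/

section Flat

variable {m : ℕ} (b : OrthonormalBasis (Fin (m + 1)) ℝ (EuclideanSpace ℝ (Fin (m + 1))))

/-- The restriction of `dropCoord j` to the hyperplane orthogonal to `b 0`, in the coordinates
given by the other vectors of `b`. -/
noncomputable def hyperplaneDrop (j : Fin (m + 1)) :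
    EuclideanSpace ℝ (Fin m) →ₗ[ℝ] EuclideanSpace ℝ (Fin m) :=
  Matrix.toLin (PiLp.basisFun 2 ℝ (Fin m)) (PiLp.basisFun 2 ℝ (Fin m))
    ((Matrix.of fun i k => b k i).submatrix j.succAbove Fin.succ)

/-- Expand the orthogonal matrix with columns `b k` along column `0`: the minors are these
determinants, and the entries `b 0 j` are at most `1` in absolute value. -/
theorem one_le_sum_abs_det_hyperplaneDrop :
    1 ≤ ∑ j, |LinearMap.det (hyperplaneDrop b j)| := by
  have hdet : |(Matrix.of fun i k => b k i).det| = 1 := by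
    have h := (EuclideanSpace.basisFun (Fin (m + 1)) ℝ).det_to_matrix_orthonormalBasis_real b
    have hM : (EuclideanSpace.basisFun (Fin (m + 1)) ℝ).toBasis.toMatrix b =
        Matrix.of fun i k => b k i := by
      ext i k
      simp [Module.Basis.toMatrix_apply]
    rw [Module.Basis.det_apply, hM] at h
    rcases h with h | h <;> simp [h]
  rw [← hdet, Matrix.det_succ_column_zero]
  refine (Finset.abs_sum_le_sum_abs _ _).trans (Finset.sum_le_sum fun j _ => ?_)
  have hb : |b 0 j| ≤ 1 := by
    have := PiLp.norm_apply_le (b 0) j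
    simpa using this
  rw [hyperplaneDrop, LinearMap.det_toLin, abs_mul, abs_mul, abs_pow, abs_neg, abs_one, one_pow,
    one_mul]
  exact mul_le_of_le_one_left (abs_nonneg _) hb

theorem dropCoord_eq_hyperplaneDrop_add (j : Fin (m + 1)) (v : EuclideanSpace ℝ (Fin (m + 1))) :
    dropCoord j v = hyperplaneDrop b j (dropCoord 0 (b.repr v)) +
      b.repr v 0 • dropCoord j (b 0) := by
  ext i
  conv_lhs => rw [← b.sum_repr v]
  simp only [dropCoord_apply, Fin.sum_univ_succ, hyperplaneDrop, Matrix.toLin_apply]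
  simp [Matrix.mulVec, dotProduct, Pi.single_apply, add_comm, mul_comm]

/-- A vector that is nearly orthogonal to `b 0` is nearly determined, together with its
projections, by its component orthogonal to `b 0`. -/
theorem exists_flatness {K : ℝ} (hK : 1 < K) :
    ∃ ε : ℝ, 0 < ε ∧ ∀ v : EuclideanSpace ℝ (Fin (m + 1)),
    |b.repr v 0| ≤ ε * ‖v‖ → ‖v‖ ≤ K * ‖dropCoord 0 (b.repr v)‖ ∧
      ∀ j, LinearMap.det (hyperplaneDrop b j) ≠ 0 →
        ‖hyperplaneDrop b j (dropCoord 0 (b.repr v))‖ ≤ K * ‖dropCoord j v‖ := by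
  have hK0 : 0 < K := by linarith
  have hanti : ∀ j, ∃ c > 0, LinearMap.det (hyperplaneDrop b j) ≠ 0 →
      ∀ u, ‖u‖ ≤ c * ‖hyperplaneDrop b j u‖ := by
    intro j
    by_cases h : LinearMap.det (hyperplaneDrop b j) = 0
    · exact ⟨1, one_pos, fun h' => absurd h h'⟩
    · obtain ⟨c, hc, hL⟩ := LinearMap.exists_antilipschitzWith (hyperplaneDrop b j)
        (not_not.1 (LinearMap.det_eq_zero_iff_ker_ne_bot.not.1 h))
      exact ⟨c, hc, fun _ u => by simpa using hL.le_mul_norm_sub u 0⟩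
  choose c hc hcL using hanti
  -- Both conclusions come from a bound `p ≤ q + (1 - K⁻¹) * p`, which absorbs to `p ≤ K * q`; `ε`
  -- is chosen to make the error terms that small.
  have hev : ∀ᶠ ε in 𝓝[>] (0 : ℝ), ε ≤ 1 - K⁻¹ ∧ ∀ j, K * (c j) * ε ≤ 1 - K⁻¹ := by
    have hpos : 0 < 1 - K⁻¹ := by linarith [inv_lt_one_of_one_lt₀ hK]
    have key : ∀ a : ℝ, ∀ᶠ ε in 𝓝[>] (0 : ℝ), a * ε ≤ 1 - K⁻¹ := fun a => by
      have : Tendsto (fun ε : ℝ => a * ε) (𝓝[>] 0) (𝓝 0) := by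
        simpa using (tendsto_id.const_mul a : Tendsto _ (𝓝 (0 : ℝ)) _).mono_left nhdsWithin_le_nhds
      exact (this.eventually_lt_const hpos).mono fun _ h => h.le
    exact ((key 1).mono fun ε h => by simpa using h).and (eventually_all.2 fun j => key _)
  obtain ⟨ε, ⟨hε1, hεc⟩, hε0⟩ := (hev.and self_mem_nhdsWithin).exists
  have habs : ∀ {p q : ℝ}, p ≤ q + (1 - K⁻¹) * p → p ≤ K * q := fun {p q} h => by
    have : K⁻¹ * p ≤ q := by linarith
    rwa [inv_mul_le_iff₀ hK0] at this
  refine ⟨ε, hε0, fun v hv => ?_⟩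
  have hvK : ‖v‖ ≤ K * ‖dropCoord 0 (b.repr v)‖ := by
    have h1 := norm_le_abs_add_norm_dropCoord 0 (b.repr v)
    rw [LinearIsometryEquiv.norm_map] at h1
    refine habs ?_
    have := mul_le_mul_of_nonneg_right hε1 (norm_nonneg v)
    linarith
  refine ⟨hvK, fun j hj => habs ?_⟩
  set w := hyperplaneDrop b j (dropCoord 0 (b.repr v)) with hw
  have h1 : ‖w‖ ≤ ‖dropCoord j v‖ + ε * ‖v‖ := by
    have : w = dropCoord j v - b.repr v 0 • dropCoord j (b 0) := by
      rw [dropCoord_eq_hyperplaneDrop_add b j v, add_sub_cancel_right]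
    rw [this]
    refine (norm_sub_le _ _).trans (add_le_add_right ?_ _)
    rw [norm_smul, Real.norm_eq_abs]
    refine le_trans (mul_le_of_le_one_right (abs_nonneg _) ?_) hv
    exact (norm_dropCoord_le j (b 0)).trans (by simp)
  have h2 : ‖v‖ ≤ K * (c j * ‖w‖) := hvK.trans (by gcongr; exact hcL j hj _)
  have h3 : ε * ‖v‖ ≤ ε * (K * (c j * ‖w‖)) := mul_le_mul_of_nonneg_left h2 (le_of_lt hε0)
  have h4 := mul_le_mul_of_nonneg_right (hεc j) (norm_nonneg w)
  linarith

/-- The measure of a set that is nearly orthogonal to `b 0` is nearly bounded by the sum of the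
measures of its projections. -/
theorem exists_hausdorffMeasure_le_of_flat {K : ℝ≥0} (hK : 1 < K) :
    ∃ ε : ℝ, 0 < ε ∧ ∀ A : Set (EuclideanSpace ℝ (Fin (m + 1))),
      (∀ y ∈ A, ∀ z ∈ A, |b.repr (y - z) 0| ≤ ε * ‖y - z‖) →
        μH[(m : ℝ)] A ≤ (K : ℝ≥0∞) ^ (m : ℝ) * ((K : ℝ≥0∞) ^ (m : ℝ) *
          ∑ j, μH[(m : ℝ)] (coordProj j '' A)) := by
  obtain ⟨ε, hε, H⟩ := exists_flatness b (K := K) (by exact_mod_cast hK)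
  refine ⟨ε, hε, fun A hA => ?_⟩
  set P : EuclideanSpace ℝ (Fin (m + 1)) → EuclideanSpace ℝ (Fin m) :=
    fun y => dropCoord 0 (b.repr y) with hP
  have hPsub : ∀ y z, P y - P z = dropCoord 0 (b.repr (y - z)) := fun y z => by
    simp [hP]
  have hm : (0 : ℝ) ≤ m := Nat.cast_nonneg m
  have h1 : μH[(m : ℝ)] A ≤ (K : ℝ≥0∞) ^ (m : ℝ) * μH[(m : ℝ)] (P '' A) := by
    simpa using hausdorffMeasure_image_le_of_dist_le (f := id) (g := P) (A := A) (K := K)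
      (fun y hy z hz => by
        rw [dist_eq_norm, dist_eq_norm, hPsub]
        exact (H _ (hA y hy z hz)).1) hm
  refine h1.trans (mul_le_mul_right ?_ _)
  have h2 : (1 : ℝ≥0∞) ≤ ∑ j, ENNReal.ofReal |LinearMap.det (hyperplaneDrop b j)| := by
    rw [← ENNReal.ofReal_sum_of_nonneg fun _ _ => abs_nonneg _, ← ENNReal.ofReal_one]
    exact ENNReal.ofReal_le_ofReal (one_le_sum_abs_det_hyperplaneDrop b)
  calc μH[(m : ℝ)] (P '' A) ≤ (∑ j, ENNReal.ofReal |LinearMap.det (hyperplaneDrop b j)|) *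
        μH[(m : ℝ)] (P '' A) := le_mul_of_one_le_left' h2
    _ ≤ _ := by
      rw [Finset.sum_mul, Finset.mul_sum]
      refine Finset.sum_le_sum fun j _ => ?_
      by_cases hj : LinearMap.det (hyperplaneDrop b j) = 0
      · simp [hj]
      -- `μH[m]` on `ℝ^m` is a Haar measure, so the factor `|det|` turns into the image under
      -- `hyperplaneDrop b j`.
      rw [← Measure.addHaar_image_linearMap, image_image, hausdorffMeasure_coordProj_image j A hm]
      refine hausdorffMeasure_image_le_of_dist_le (fun y hy z hz => ?_) hm
      rw [dist_eq_norm, dist_eq_norm, ← map_sub (hyperplaneDrop b j), ← map_sub (dropCoord j)]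
      rw [← map_sub, ← map_sub]
      exact (H _ (hA y hy z hz)).2 j hj

end Flat

/-! ### Smooth hypersurfaces -/

/-- A set contained in a regular level set of a `C¹` function is nearly flat near each point. -/
theorem exists_orthonormalBasis_flat {m : ℕ} {S : Set (EuclideanSpace ℝ (Fin (m + 1)))}
    {x : EuclideanSpace ℝ (Fin (m + 1))} {g : EuclideanSpace ℝ (Fin (m + 1)) → ℝ}
    (hg : ContDiffAt ℝ 1 g x) (hg' : fderiv ℝ g x ≠ 0) (hgS : ∀ᶠ y in 𝓝[S] x, g y = 0) :
    ∃ b : OrthonormalBasis (Fin (m + 1)) ℝ (EuclideanSpace ℝ (Fin (m + 1))), ∀ ε : ℝ, 0 < ε →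
      ∃ W : Set (EuclideanSpace ℝ (Fin (m + 1))), IsOpen W ∧ x ∈ W ∧
        ∀ y ∈ S ∩ W, ∀ z ∈ S ∩ W, |b.repr (y - z) 0| ≤ ε * ‖y - z‖ := by
  set w := (InnerProductSpace.toDual ℝ (EuclideanSpace ℝ (Fin (m + 1)))).symm (fderiv ℝ g x) with hw
  have hw0 : 0 < ‖w‖ := by
    rw [hw, LinearIsometryEquiv.norm_map]
    exact norm_pos_iff.2 hg'
  have hon : Orthonormal ℝ (({0} : Set (Fin (m + 1))).domRestrict fun _ => ‖w‖⁻¹ • w) := by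
    refine ⟨fun i => ?_, fun i k hik => absurd (Subsingleton.elim i k) hik⟩
    simp [norm_smul, hw0.ne']
  obtain ⟨b, hb⟩ := hon.exists_orthonormalBasis_extension_of_card_eq (by simp)
  refine ⟨b, fun ε hε => ?_⟩
  have hrepr : ∀ v, fderiv ℝ g x v = ‖w‖ * b.repr v 0 := fun v => by
    rw [b.repr_apply_apply, hb 0 rfl, real_inner_smul_left, hw,
      InnerProductSpace.toDual_symm_apply, ← hw, mul_inv_cancel_left₀ hw0.ne']
  -- Strict differentiability controls `g y - g z` for all pairs near `x`; on `S` this difference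
  -- vanishes, leaving only the normal component of `y - z`.
  have hlo := (hg.hasStrictFDerivAt one_ne_zero).isLittleO.def (mul_pos hw0 hε)
  rw [nhds_prod_eq] at hlo
  obtain ⟨U, hU, hUlo⟩ := mem_prod_self_iff.1 hlo
  have hmem : ∀ᶠ y in 𝓝 x, y ∈ U ∧ (y ∈ S → g y = 0) :=
    (Filter.Eventually.and hU (eventually_nhdsWithin_iff.1 hgS))
  obtain ⟨W, hWs, hWo, hxW⟩ := _root_.mem_nhds_iff.1 hmem
  refine ⟨W, hWo, hxW, fun y hy z hz => ?_⟩
  have h := hUlo (mk_mem_prod (hWs hy.2).1 (hWs hz.2).1)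
  simp only [mem_ofPred_eq, (hWs hy.2).2 hy.1, (hWs hz.2).2 hz.1, hrepr, sub_zero, zero_sub,
    Real.norm_eq_abs] at h
  rw [mul_assoc, abs_neg, abs_mul, abs_norm] at h
  exact le_of_mul_le_mul_left h hw0

/-- A Borel set with injective coordinate projections, each point of which has a neighbourhood
where the projection inequality holds up to the constant `C`, satisfies that inequality. -/
theorem hausdorffMeasure_le_sum_of_locally {n : ℕ} {d : ℝ} {T : Set (EuclideanSpace ℝ (Fin n))}
    (hT : MeasurableSet T) (hinj : ∀ j, InjOn (coordProj j) T) {C : ℝ≥0∞}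
    (hloc : ∀ x ∈ T, ∃ W : Set (EuclideanSpace ℝ (Fin n)), IsOpen W ∧ x ∈ W ∧ ∀ A ⊆ T ∩ W,
      μH[d] A ≤ C * ∑ j, μH[d] (coordProj j '' A)) :
    μH[d] T ≤ C * ∑ j, μH[d] (coordProj j '' T) := by
  rcases T.eq_empty_or_nonempty with rfl | hne
  · simp
  choose! W hWo hxW hW using hloc
  obtain ⟨t, htT, htc, hcov⟩ := TopologicalSpace.countable_cover_nhdsWithin (f := W) (s := T)
    fun x hx => mem_nhdsWithin_of_mem_nhds ((hWo x hx).mem_nhds (hxW x hx))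
  have htne : t.Nonempty := by
    obtain ⟨x, hx⟩ := hne
    obtain ⟨y, hy, -⟩ := mem_iUnion₂.1 (hcov hx)
    exact ⟨y, hy⟩
  obtain ⟨u, rfl⟩ := htc.exists_eq_range htne
  have huT : ∀ k, u k ∈ T := fun k => htT (mem_range_self k)
  -- The local bound holds for every subset of `T ∩ W`, so it survives cutting the cover into
  -- disjoint pieces.
  let A : ℕ → Set (EuclideanSpace ℝ (Fin n)) := disjointed fun k => T ∩ W (u k)
  have hAm : ∀ k, MeasurableSet (A k) := fun k =>
    MeasurableSet.disjointed (fun k => hT.inter (hWo _ (huT k)).measurableSet) k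
  have hAsub : ∀ k, A k ⊆ T ∩ W (u k) := disjointed_subset _
  have hAT : ⋃ k, A k = T := by
    rw [iUnion_disjointed, ← inter_iUnion]
    exact inter_eq_left.2 (by simpa [biUnion_range] using hcov)
  have hdisj : Pairwise (Function.onFun Disjoint A) := disjoint_disjointed _
  have hproj : ∀ j, ∑' k, μH[d] (coordProj j '' A k) = μH[d] (coordProj j '' T) := fun j => by
    rw [← measure_iUnion, ← image_iUnion, hAT]
    · intro k l hkl
      refine disjoint_left.2 ?_
      rintro _ ⟨x, hx, rfl⟩ ⟨y, hy, hxy⟩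
      have := hinj j (hAsub l hy).1 (hAsub k hx).1 hxy
      exact disjoint_left.1 (hdisj hkl) hx (this ▸ hy)
    -- Lusin–Souslin: injective continuous images of Borel sets are Borel.
    · exact fun k => (hAm k).image_of_continuousOn_injOn (continuous_coordProj j).continuousOn
        ((hinj j).mono ((hAsub k).trans inter_subset_left))
  calc μH[d] T = μH[d] (⋃ k, A k) := by rw [hAT]
    _ ≤ ∑' k, μH[d] (A k) := measure_iUnion_le _
    _ ≤ ∑' k, C * ∑ j, μH[d] (coordProj j '' A k) :=
      ENNReal.tsum_le_tsum fun k => hW _ (huT k) _ (hAsub k)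
    _ = C * ∑ j, μH[d] (coordProj j '' T) := by
      rw [ENNReal.tsum_mul_left, Summable.tsum_finsetSum fun _ _ => ENNReal.summable]
      simp_rw [hproj]

theorem IsSmoothHypersurface.hausdorffMeasure_le_sum_of_injOn {m : ℕ}
    {S : Set (EuclideanSpace ℝ (Fin (m + 1)))} (hS : IsSmoothHypersurface S)
    (hinj : ∀ j, InjOn (coordProj j) S) :
    μH[(m : ℝ)] S ≤ ∑ j, μH[(m : ℝ)] (coordProj j '' S) := by
  -- A Borel subset of full measure suffices: passing from `T` back to `S` only enlarges the
  -- right-hand side.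
  obtain ⟨T, hTS, hTm, hTae⟩ := hS.measurable.exists_measurable_subset_ae_eq
  have hμ : μH[(m : ℝ)] S = μH[(m : ℝ)] T := (measure_congr hTae).symm
  suffices h : μH[(m : ℝ)] T ≤ ∑ j, μH[(m : ℝ)] (coordProj j '' T) by
    rw [hμ]
    exact h.trans (Finset.sum_le_sum fun j _ => measure_mono (image_mono hTS))
  have hK : ∀ K : ℝ≥0, 1 < K → μH[(m : ℝ)] T ≤
      (K : ℝ≥0∞) ^ (m : ℝ) * (K : ℝ≥0∞) ^ (m : ℝ) * ∑ j, μH[(m : ℝ)] (coordProj j '' T) := by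
    intro K hK
    refine hausdorffMeasure_le_sum_of_locally hTm (fun j => (hinj j).mono hTS) fun x hx => ?_
    obtain ⟨g, hg, hg', hgS⟩ := hS.exists_defining x (hTS hx)
    obtain ⟨b, hb⟩ := exists_orthonormalBasis_flat hg hg' (hgS.filter_mono (nhdsWithin_mono x hTS))
    obtain ⟨ε, hε, hflat⟩ := exists_hausdorffMeasure_le_of_flat b hK
    obtain ⟨W, hWo, hxW, hW⟩ := hb ε hε
    refine ⟨W, hWo, hxW, fun A hA => ?_⟩
    rw [mul_assoc]
    exact hflat A fun y hy z hz => hW y (hA hy) z (hA hz)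
  have hlim : Tendsto (fun K : ℝ≥0 => (K : ℝ≥0∞) ^ (m : ℝ) * (K : ℝ≥0∞) ^ (m : ℝ) *
      ∑ j, μH[(m : ℝ)] (coordProj j '' T)) (𝓝[>] 1)
      (𝓝 (1 * ∑ j, μH[(m : ℝ)] (coordProj j '' T))) := by
    -- The sum may be `∞`; the product still converges because the limit `1` of the first factor is
    -- nonzero.
    refine ENNReal.Tendsto.mul_const (Tendsto.mono_left ?_ nhdsWithin_le_nhds) (Or.inl one_ne_zero)
    have h : Tendsto (fun K : ℝ≥0 => ((K ^ m * K ^ m : ℝ≥0) : ℝ≥0∞)) (𝓝 1) (𝓝 1) := by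
      have hc : Continuous fun K : ℝ≥0 => K ^ m * K ^ m := by fun_prop
      simpa using ENNReal.tendsto_coe.2 (hc.tendsto 1)
    simpa using h
  rw [one_mul] at hlim
  exact ge_of_tendsto hlim (eventually_mem_nhdsWithin.mono hK)

theorem theorem1p6 (n : ℕ) (hn : 1 ≤ n) (S : Set (EuclideanSpace ℝ (Fin n)))
    (hS : IsCubeAntichain S) (hsmooth : IsSmoothHypersurface S) :
    μH[((n - 1 : ℕ) : ℝ)] S ≤ ∑ j : Fin n, μH[((n - 1 : ℕ) : ℝ)] (coordProj j '' S) ∧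
      μH[((n - 1 : ℕ) : ℝ)] S ≤ (n : ENNReal) * ENNReal.ofReal (sigmaConst (n - 1)) := by
  obtain ⟨m, rfl⟩ : ∃ m, n = m + 1 := ⟨n - 1, by omega⟩
  rw [Nat.add_sub_cancel]
  have h := hsmooth.hausdorffMeasure_le_sum_of_injOn hS.injOn_coordProj
  refine ⟨h, h.trans ?_⟩
  refine (Finset.sum_le_sum fun j _ => hS.hausdorffMeasure_coordProj_image_le j).trans_eq ?_
  simp
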